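/- Let $K\ge 2$, $\eta\in(0,1)$ and $0\le r_{\min}<r_{\max}$. Consider $K$ bidders (access point owners) whose types $r_1,\dots,r_K$ are independent and identically distributed on $[r_{\min},r_{\max}]$ with a density $f$ that is positive on $[r_{\min},r_{\max}]$; let $F$ be their distribution function. Fix a reserve rate $C\in[r_{\min},r_{\max})$ with $C>0$. Bidder $k$ learns only its own type $r_k$ and submits a bid $b_k\in[0,C]\cup\{\text{``N''}\}$, where "N" counts as larger than every number. Let $m=\min_j b_j$ and let $I$ be the set of bidders $j$ with $b_j=m$. The payoff of bidder $k$ is - $r_k$ if $b_k>m$; - $\frac{1}{|I|}\,r_{\mathrm{pay}}+\frac{|I|-1}{|I|}\,r_k$ if $b_k=m\in[0,C]$, where $r_{\mathrm{pay}}=\min\{C,\min_{j\ne k}b_j\}$ if $|I|=1$ and $r_{\mathrm{pay}}=m$ if $|I|>1$; - $\frac{K-1+\eta}{K}\,r_k$ if all bids are "N". A (measurable) strategy $b:[r_{\min},r_{\max}]\to[0,C]\cup\{\text{``N''}\}$ is a symmetric Bayesian Nash equilibrium if, for every bidder $k$, every type $r_k\in[r_{\min},r_{\max}]$ and every bid $s\in[0,C]\cup\{\text{``N''}\}$,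 the expected payoff of bidder $k$ from bidding $b(r_k)$ is at least that from bidding $s$, when the other bidders use $b$ and the expectation is over their types. Then $b$ is a symmetric Bayesian Nash equilibrium if and only if there is an $r_T\in(C,r_{\max})$ that solves $$\sum_{n=1}^{K-1}\binom{K-1}{n}\bigl(F(r)-F(C)\bigr)^n\bigl(1-F(r)\bigr)^{K-1-n}\,\frac{C-r}{n+1}+\bigl(1-F(r)\bigr)^{K-1}\Bigl(C-\frac{K-1+\eta}{K}\,r\Bigr)=0$$ (in the unknown $r=r_T$) and for which $$b(r)\in[0,r_{\min}]\ \text{ if } r=r_{\min},\qquad b(r)=r\ \text{ if } r\in(r_{\min},C],\qquad b(r)=C\ \text{ if } r\in(C,r_T),$$ $$b(r_T)\in\{C,\text{``N''}\},\qquad b(r)=\text{``N''}\ \text{ if } r\in(r_T,r_{\max}].$$ -/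

import Mathlib

open Set MeasureTheory

noncomputable section

namespace ReverseAuction

/-- A bid is either a rate `x` (written `(x : Bid)`) or the refusal "N" (written `⊤`), which
counts as larger than every rate. -/
abbrev Bid : Type := WithTop ℝ

/-- The bids that are allowed under the reserve rate `C`: the set `[0, C] ∪ {"N"}`. -/
def feasibleBids (C : ℝ) : Set Bid :=
  ((fun x : ℝ => (x : Bid)) '' Icc 0 C) ∪ {⊤}

/-- The smallest bid of a bid profile (it is "N" iff everybody bids "N"). -/
def minBid {K : ℕ} (b : Fin K → Bid) : Bid :=
  Finset.univ.inf b

/-- The set of bidders that submit the smallest bid. -/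
def minBidders {K : ℕ} (b : Fin K → Bid) : Finset (Fin K) :=
  Finset.univ.filter fun i => b i = minBid b

/-- The rate with which the auctioneer serves the winner. If there is a single smallest bid, by
bidder `i` say, it is the smallest of `C` and of the bids of the others (the bidders outside
`minBidders b = {i}`). If several bidders submit the smallest bid, it is that bid. It is `0` if
everybody bids "N". -/
def payRate {K : ℕ} (C : ℝ) (b : Fin K → Bid) : ℝ :=
  if (minBidders b).card = 1 then
    (min (C : Bid) ((Finset.univ \ minBidders b).inf b)).untopD 0
  else (minBid b).untopD 0

/-- The (expected, over the uniform tie-breaking and the uniform channel choice) payoff of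
bidder `k` of type `t` at the bid profile `b`:
another bidder wins for sure; or `k` is among the smallest bidders; or everybody bids "N". -/
def payoff {K : ℕ} (η C : ℝ) (k : Fin K) (t : ℝ) (b : Fin K → Bid) : ℝ :=
  if minBid b < b k then t
  else if minBid b ≠ ⊤ then
    1 / ((minBidders b).card : ℝ) * payRate C b
      + (((minBidders b).card : ℝ) - 1) / ((minBidders b).card : ℝ) * t
  else ((K : ℝ) - 1 + η) / (K : ℝ) * t

/-- The law on `[rmin, rmax]` with density `f`. -/
def typeLaw (rmin rmax : ℝ) (f : ℝ → ℝ) : Measure ℝ :=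
  (volume.restrict (Icc rmin rmax)).withDensity fun r => ENNReal.ofReal (f r)

/-- The bid profile in which bidder `k` bids `s`, and every other bidder `j` has type `ρ j` and
follows the strategy `b`. -/
def bidProfile {K : ℕ} (b : ℝ → Bid) (k : Fin K) (s : Bid) (ρ : {j : Fin K // j ≠ k} → ℝ) :
    Fin K → Bid :=
  fun j => if h : j = k then s else b (ρ ⟨j, h⟩)

/-- The expected payoff of bidder `k` of type `t` that bids `s`, when the types of the others are
independent with law `μ` and the others follow the strategy `b`. -/
def expectedPayoff {K : ℕ} (μ : Measure ℝ) (η C : ℝ) (b : ℝ → Bid) (k : Fin K) (t : ℝ)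
    (s : Bid) : ℝ :=
  ∫ ρ, payoff η C k t (bidProfile b k s ρ) ∂(Measure.pi fun _ : {j : Fin K // j ≠ k} => μ)

/-- The strategy `b` is a symmetric Bayesian Nash equilibrium of the game with `K` bidders and
reserve rate `C`: it is a (measurable) feasible strategy, and no type of any bidder gains by
deviating to another feasible bid. Values of `b` outside `[rmin, rmax]` play no role. -/
structure IsSBNE (K : ℕ) (η rmin rmax : ℝ) (f : ℝ → ℝ) (C : ℝ) (b : ℝ → Bid) : Prop where
  measurable : AEMeasurable b (typeLaw rmin rmax f)
  feasible : ∀ r ∈ Icc rmin rmax, b r ∈ feasibleBids C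
  optimal : ∀ k : Fin K, ∀ r ∈ Icc rmin rmax, ∀ s ∈ feasibleBids C,
    expectedPayoff (typeLaw rmin rmax f) η C b k r s ≤
      expectedPayoff (typeLaw rmin rmax f) η C b k r (b r)

/-- The left-hand side of the equation for the threshold, with `F` the distribution function of
the types. -/
def thresholdFun (K : ℕ) (η : ℝ) (F : ℝ → ℝ) (C r : ℝ) : ℝ :=
  ∑ n ∈ Finset.Icc 1 (K - 1),
      ((K - 1).choose n : ℝ) * (F r - F C) ^ n * (1 - F r) ^ (K - 1 - n) * ((C - r) / ((n : ℝ) + 1))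
    + (1 - F r) ^ (K - 1) * (C - ((K : ℝ) - 1 + η) / (K : ℝ) * r)

/-- The three-region form of a strategy with threshold `rT`. -/
structure HasThreeRegionForm (rmin rmax C rT : ℝ) (b : ℝ → Bid) : Prop where
  at_min : ∃ x ∈ Icc 0 rmin, b rmin = (x : Bid)
  truthful : ∀ r ∈ Ioc rmin C, b r = (r : Bid)
  reserve : ∀ r ∈ Ioo C rT, b r = (C : Bid)
  at_threshold : b rT = (C : Bid) ∨ b rT = ⊤
  refuse : ∀ r ∈ Ioc rT rmax, b r = ⊤

end ReverseAuction

end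

open Set MeasureTheory

noncomputable section

namespace ReverseAuction

/-! Against fixed rival bids the game is a second-price auction capped at `C`, with a refusal
option. A type `t ≤ C` has the truthful bid as a weakly dominant choice, and a type `t ≥ C` weakly
prefers `C` to every lower rate. Only the choice between `C` and "N" for types above `C` depends on
the rivals' strategy.

Necessity. If a weakly dominated bid is optimal, then the rival bids against which the domination is
strict have probability zero (`measure_preimage_eq_zero_of_dominated`). Hence a non-truthful type
below `C`, or a type above `C` that bids below `C`, has its own bid at the end of an interval that
almost no type bids in. No regularity of `b` is assumed, but for almost every type the value of `b`
is not the end of such a gap (`ae_measure_Ico_ne_zero`, `ae_measure_Ioc_ne_zero`). So the strategy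
has the claimed shape almost everywhere. As `f` is positive, these truthful bids fill every interval
of rates in `[rmin, C]`, so no single type can own a gap; only underbidding at `rmin` survives.

Let `p` and `q` be the probabilities of the bids `C` and "N". Both are positive (`refusal_pos`,
`reserve_pos`). With `p` and `q` held fixed, the advantage of `C` over "N" is strictly decreasing in
the own type and positive at `C`, and it is nonpositive at any refusing type. Its zero is `rT`, and
substituting `p = F rT - F C` and `q = 1 - F rT` gives the threshold equation.

Sufficiency is dominance together with the sign of the same advantage on either side of `rT`. -/

/-! ### The payoff of a bidder in terms of the bids of its rivals -/

/-- The smallest bid of the rivals. -/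
def minRival {ι : Type*} [Fintype ι] (x : ι → Bid) : Bid :=
  Finset.univ.inf x

/-- The number of rivals that bid `s`. -/
def numTies {ι : Type*} [Fintype ι] (s : Bid) (x : ι → Bid) : ℕ :=
  (Finset.univ.filter fun j => x j = s).card

/-- The payoff of a bidder of type `t` with bid `s` against the rival bids `x`. -/
def rivalPayoff {ι : Type*} [Fintype ι] (K : ℕ) (η C t : ℝ) (s : Bid) (x : ι → Bid) : ℝ :=
  if minRival x < s then t
  else if s = ⊤ then ((K : ℝ) - 1 + η) / (K : ℝ) * t
  else if s < minRival x then (min (C : Bid) (minRival x)).untopD 0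
  else 1 / ((numTies s x : ℝ) + 1) * s.untopD 0
    + (numTies s x : ℝ) / ((numTies s x : ℝ) + 1) * t

section Profile

variable {K : ℕ} (b : ℝ → Bid) (k : Fin K) (s : Bid) (ρ : {j : Fin K // j ≠ k} → ℝ)

lemma bidProfile_self : bidProfile b k s ρ k = s := by simp [bidProfile]

lemma bidProfile_of_ne (j : {j : Fin K // j ≠ k}) : bidProfile b k s ρ j = b (ρ j) := by
  simp [bidProfile, j.2]

lemma inf_erase_bidProfile :
    (Finset.univ.erase k).inf (bidProfile b k s ρ) = minRival fun j => b (ρ j) := by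
  apply le_antisymm
  · refine Finset.le_inf fun j _ => ?_
    rw [← bidProfile_of_ne b k s ρ j]
    exact Finset.inf_le (Finset.mem_erase.2 ⟨j.2, Finset.mem_univ _⟩)
  · refine Finset.le_inf fun j hj => ?_
    have hj' := Finset.ne_of_mem_erase hj
    rw [show bidProfile b k s ρ j = b (ρ ⟨j, hj'⟩) from bidProfile_of_ne b k s ρ ⟨j, hj'⟩]
    exact Finset.inf_le (f := fun j => b (ρ j)) (Finset.mem_univ _)

lemma minBid_bidProfile :
    minBid (bidProfile b k s ρ) = min s (minRival fun j => b (ρ j)) := by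
  rw [minBid, ← Finset.insert_erase (Finset.mem_univ k), Finset.inf_insert,
    inf_erase_bidProfile, bidProfile_self]

lemma card_filter_erase_bidProfile (m : Bid) :
    ((Finset.univ.erase k).filter fun i => bidProfile b k s ρ i = m).card
      = numTies m fun j => b (ρ j) := by
  symm
  refine Finset.card_bij (fun j _ => j.1) ?_ ?_ ?_
  · intro j hj
    simp only [Finset.mem_filter, Finset.mem_univ, true_and] at hj
    simp [bidProfile_of_ne, hj, j.2]
  · intro i _ j _ h
    exact Subtype.ext h
  · intro j hj
    simp only [Finset.mem_filter, Finset.mem_erase, Finset.mem_univ, and_true] at hj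
    refine ⟨⟨j, hj.1⟩, ?_, rfl⟩
    simp only [Finset.mem_filter, Finset.mem_univ, true_and]
    exact (bidProfile_of_ne b k s ρ ⟨j, hj.1⟩).symm.trans hj.2

lemma card_minBidders_bidProfile (h : s ≤ minRival fun j => b (ρ j)) :
    (minBidders (bidProfile b k s ρ)).card = (numTies s fun j => b (ρ j)) + 1 := by
  have hm : minBid (bidProfile b k s ρ) = s := by rw [minBid_bidProfile, min_eq_left h]
  rw [minBidders, hm, ← Finset.insert_erase (Finset.mem_univ k), Finset.filter_insert,
    if_pos (bidProfile_self b k s ρ), Finset.card_insert_of_notMem (by simp),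
    card_filter_erase_bidProfile]

/-- Removes the bidder from its own profile: all later comparisons fix the rival bids and vary `s`
only. -/
lemma payoff_bidProfile (η C t : ℝ) :
    payoff η C k t (bidProfile b k s ρ) = rivalPayoff K η C t s fun j => b (ρ j) := by
  unfold payoff rivalPayoff
  rw [bidProfile_self]
  by_cases h1 : (minRival fun j => b (ρ j)) < s
  · rw [if_pos h1, if_pos (by rw [minBid_bidProfile]; exact min_lt_of_right_lt h1)]
  have h1' := not_lt.1 h1
  have hm : minBid (bidProfile b k s ρ) = s := by rw [minBid_bidProfile, min_eq_left h1']
  rw [hm, if_neg (lt_irrefl s), if_neg h1]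
  by_cases h2 : s = ⊤
  · simp [h2]
  rw [if_pos h2, if_neg h2, card_minBidders_bidProfile b k s ρ h1']
  by_cases h3 : s < minRival fun j => b (ρ j)
  · have h0 : (numTies s fun j => b (ρ j)) = 0 := by
      rw [numTies, Finset.card_eq_zero, Finset.filter_eq_empty_iff]
      intro j _ hj
      exact absurd (Finset.inf_le (f := fun j => b (ρ j)) (Finset.mem_univ j))
        (not_le.2 (by rw [hj]; exact h3))
    have hone := card_minBidders_bidProfile b k s ρ h1'
    rw [h0, zero_add] at hone
    have hmem : k ∈ minBidders (bidProfile b k s ρ) := by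
      simp [minBidders, hm, bidProfile_self]
    have hsing : minBidders (bidProfile b k s ρ) = {k} := by
      obtain ⟨a, ha⟩ := Finset.card_eq_one.1 hone
      rw [ha] at hmem ⊢
      rw [Finset.mem_singleton.1 hmem]
    rw [if_pos h3, h0, payRate, if_pos hone, hsing, Finset.sdiff_singleton_eq_erase,
      inf_erase_bidProfile]
    simp
  · have heq : s = minRival fun j => b (ρ j) := le_antisymm h1' (not_lt.1 h3)
    -- A bidder without rivals would face an empty infimum, which is "N"; since `s` is a rate equal
    -- to that infimum, some rival attains it, and `payRate` takes its tie branch.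
    have hpos : (numTies s fun j => b (ρ j)) ≠ 0 := by
      rw [numTies, Finset.card_ne_zero]
      have hne : (Finset.univ : Finset {j : Fin K // j ≠ k}).Nonempty := by
        rw [Finset.nonempty_iff_ne_empty]
        intro he
        apply h2
        rw [heq, minRival, he, Finset.inf_empty]
      obtain ⟨j, _, hj⟩ := Finset.exists_mem_eq_inf _ hne fun j => b (ρ j)
      exact ⟨j, by simp only [Finset.mem_filter, Finset.mem_univ, true_and]; rw [heq]; exact hj.symm⟩
    rw [if_neg h3, payRate, card_minBidders_bidProfile b k s ρ h1', if_neg (by omega), hm]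
    push_cast
    ring_nf

end Profile

/-! ### Payoff by the position of the smallest rival bid -/

section Comparison

variable {ι : Type*} [Fintype ι] {K : ℕ} {η C t : ℝ} {x : ι → Bid}

lemma rivalPayoff_of_lt {s : Bid} (h : minRival x < s) : rivalPayoff K η C t s x = t := if_pos h

lemma rivalPayoff_top (h : minRival x = ⊤) :
    rivalPayoff K η C t ⊤ x = ((K : ℝ) - 1 + η) / (K : ℝ) * t := by
  simp [rivalPayoff, h]

lemma rivalPayoff_of_gt {s : ℝ} (h : (s : Bid) < minRival x) :
    rivalPayoff K η C t s x = (min (C : Bid) (minRival x)).untopD 0 := by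
  simp [rivalPayoff, h, h.le]

lemma rivalPayoff_of_gt_coe {s m : ℝ} (hm : minRival x = m) (h : s < m) :
    rivalPayoff K η C t s x = min C m := by
  rw [rivalPayoff_of_gt (by rw [hm]; exact_mod_cast h), hm, ← WithTop.coe_min]
  rfl

lemma rivalPayoff_of_gt_top {s : ℝ} (hm : minRival x = ⊤) :
    rivalPayoff K η C t s x = C := by
  rw [rivalPayoff_of_gt (by rw [hm]; exact WithTop.coe_lt_top s), hm, min_top_right]
  rfl

/-- Written as the outside value `t` plus an equal share of the surplus `s - t`, so that comparisons
reduce to the sign of the surplus. -/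
lemma rivalPayoff_of_eq {s : ℝ} (h : minRival x = s) :
    rivalPayoff K η C t s x = t + (s - t) / ((numTies (s : Bid) x : ℝ) + 1) := by
  have : (numTies (s : Bid) x : ℝ) + 1 ≠ 0 := by positivity
  simp only [rivalPayoff, h, lt_irrefl, if_false, WithTop.coe_ne_top, WithTop.untopD_coe]
  field_simp
  ring

lemma numTies_pos [Nonempty ι] {s : Bid} (h : minRival x = s) : 1 ≤ numTies s x := by
  obtain ⟨j, _, hj⟩ := Finset.exists_mem_eq_inf _ (Finset.univ_nonempty (α := ι)) x
  refine Finset.card_pos.2 ⟨j, ?_⟩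
  simp only [Finset.mem_filter, Finset.mem_univ, true_and]
  rw [← hj]; exact h

lemma minRival_mem [Nonempty ι] {A : Set Bid} (h : ∀ j, x j ∈ A) : minRival x ∈ A := by
  obtain ⟨j, _, hj⟩ := Finset.exists_mem_eq_inf _ (Finset.univ_nonempty (α := ι)) x
  rw [minRival, hj]; exact h j

/-- The payoff of a rate bid, by the position of the smallest rival bid. -/
lemma rivalPayoff_coe_cases (s : ℝ) (x : ι → Bid) :
    (minRival x = ⊤ ∧ rivalPayoff K η C t s x = C) ∨
    (∃ m : ℝ, minRival x = m ∧
      ((m < s ∧ rivalPayoff K η C t s x = t) ∨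
       (s < m ∧ rivalPayoff K η C t s x = min C m) ∨
       (m = s ∧ rivalPayoff K η C t s x
          = t + (m - t) / ((numTies (m : Bid) x : ℝ) + 1)))) := by
  rcases h : minRival x with _ | m
  · left; exact ⟨rfl, rivalPayoff_of_gt_top h⟩
  · right
    refine ⟨m, rfl, ?_⟩
    rcases lt_trichotomy m s with hlt | heq | hgt
    · left; exact ⟨hlt, rivalPayoff_of_lt (by rw [h]; exact WithTop.coe_lt_coe.2 hlt)⟩
    · right; right; subst heq; exact ⟨rfl, rivalPayoff_of_eq h⟩
    · right; left; exact ⟨hgt, rivalPayoff_of_gt_coe h hgt⟩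

end Comparison

/-! ### Weak and strict dominance between bids -/

section Dominance

variable {ι : Type*} [Fintype ι] {K : ℕ} {η C t s : ℝ} {x : ι → Bid}

lemma refusal_factor_lt_one (hK : 2 ≤ K) (hη : η < 1) : ((K : ℝ) - 1 + η) / (K : ℝ) < 1 := by
  have : (2 : ℝ) ≤ K := by exact_mod_cast hK
  rw [div_lt_one (by linarith)]
  linarith

lemma refusal_factor_pos (hK : 2 ≤ K) (hη : 0 < η) : 0 < ((K : ℝ) - 1 + η) / (K : ℝ) := by
  have : (2 : ℝ) ≤ K := by exact_mod_cast hK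
  exact div_pos (by linarith) (by linarith)

/-- For `t = 0` the strictness comes from `C > 0`, for `t > 0` from the factor being below one. -/
lemma refusal_payoff_lt (hK : 2 ≤ K) (hη : η < 1) (hC : 0 < C) (ht : 0 ≤ t) (htC : t ≤ C) :
    ((K : ℝ) - 1 + η) / (K : ℝ) * t < C := by
  rcases ht.eq_or_lt with rfl | h
  · simpa using hC
  · nlinarith [refusal_factor_lt_one hK hη]

lemma div_natCast_add_one_le {d : ℝ} (hd : 0 ≤ d) (n : ℕ) : d / ((n : ℝ) + 1) ≤ d :=
  div_le_self hd (by linarith [n.cast_nonneg (α := ℝ)])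

lemma div_natCast_add_one_nonneg {d : ℝ} (hd : 0 ≤ d) (n : ℕ) : 0 ≤ d / ((n : ℝ) + 1) :=
  div_nonneg hd (by linarith [n.cast_nonneg (α := ℝ)])

lemma div_natCast_add_one_lt {d : ℝ} (hd : 0 < d) {n : ℕ} (hn : 1 ≤ n) :
    d / ((n : ℝ) + 1) < d :=
  div_lt_self hd (by have : (1 : ℝ) ≤ n := by exact_mod_cast hn
                     linarith)

lemma div_natCast_add_one_pos {d : ℝ} (hd : 0 < d) (n : ℕ) : 0 < d / ((n : ℝ) + 1) :=
  div_pos hd (by linarith [n.cast_nonneg (α := ℝ)])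

lemma neg_div_natCast_add_one (a c : ℝ) (n : ℕ) :
    (a - c) / ((n : ℝ) + 1) = -((c - a) / ((n : ℝ) + 1)) := by
  rw [← neg_div, neg_sub]

/-- Truthful bidding weakly dominates every other rate. -/
lemma rivalPayoff_le_truthful (htC : t ≤ C) (hsC : s ≤ C) :
    rivalPayoff K η C t s x ≤ rivalPayoff K η C t t x := by
  rcases rivalPayoff_coe_cases (K := K) (η := η) (C := C) (t := t) s x with
    ⟨h, e⟩ | ⟨m, h, hs⟩
  · rw [e, rivalPayoff_of_gt_top h]
  rcases rivalPayoff_coe_cases (K := K) (η := η) (C := C) (t := t) t x with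
    ⟨h', e⟩ | ⟨m', h', ht⟩
  · rw [h] at h'; cases h'
  obtain rfl : m = m' := WithTop.coe_injective (h.symm.trans h')
  -- The second-price argument: where the two bids give different outcomes, `m` lies between them.
  -- The lower bid then wins or shares at a price on the wrong side of `t`, or the higher bid
  -- forgoes a gain.
  rcases hs with ⟨a, e⟩ | ⟨a, e⟩ | ⟨a, e⟩ <;> rcases ht with ⟨a', e'⟩ | ⟨a', e'⟩ | ⟨a', e'⟩ <;>
    rw [e, e']
  · exact le_min htC a'.le
  · subst a'; simp
  · exact (min_le_right _ _).trans a'.le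
  · subst a'; simp
  · subst a
    rw [neg_div_natCast_add_one]
    linarith [div_natCast_add_one_nonneg (sub_nonneg.2 a'.le) (numTies (m : Bid) x)]
  · subst a
    rw [min_eq_right hsC]
    linarith [div_natCast_add_one_le (sub_nonneg.2 a'.le) (numTies (m : Bid) x)]

/-- Truthful bidding weakly dominates the refusal. -/
lemma rivalPayoff_top_le_truthful (hK : 2 ≤ K) (hη : η < 1) (hC : 0 < C) (ht : 0 ≤ t)
    (htC : t ≤ C) : rivalPayoff K η C t ⊤ x ≤ rivalPayoff K η C t t x := by
  rcases rivalPayoff_coe_cases (K := K) (η := η) (C := C) (t := t) t x with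
    ⟨h, e⟩ | ⟨m, h, hs⟩
  · rw [e, rivalPayoff_top h]
    exact (refusal_payoff_lt hK hη hC ht htC).le
  · rw [rivalPayoff_of_lt (by rw [h]; exact WithTop.coe_lt_top m)]
    rcases hs with ⟨a, e⟩ | ⟨a, e⟩ | ⟨a, e⟩ <;> rw [e]
    · exact le_min htC a.le
    · subst a; simp

/-- The types above the reserve rate weakly prefer the reserve rate to any lower bid. -/
lemma rivalPayoff_le_reserve (htC : C ≤ t) (hsC : s ≤ C) :
    rivalPayoff K η C t s x ≤ rivalPayoff K η C t C x := by
  rcases rivalPayoff_coe_cases (K := K) (η := η) (C := C) (t := t) s x with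
    ⟨h, e⟩ | ⟨m, h, hs⟩
  · rw [e, rivalPayoff_of_gt_top h]
  rcases rivalPayoff_coe_cases (K := K) (η := η) (C := C) (t := t) C x with
    ⟨h', e⟩ | ⟨m', h', ht⟩
  · rw [h] at h'; cases h'
  obtain rfl : m = m' := WithTop.coe_injective (h.symm.trans h')
  rcases hs with ⟨a, e⟩ | ⟨a, e⟩ | ⟨a, e⟩ <;> rcases ht with ⟨a', e'⟩ | ⟨a', e'⟩ | ⟨a', e'⟩ <;>
    rw [e, e']
  · linarith
  · linarith
  · exact (min_le_left _ _).trans htC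
  · subst a'
    rw [min_self, neg_div_natCast_add_one]
    linarith [div_natCast_add_one_le (sub_nonneg.2 htC) (numTies (m : Bid) x)]
  · rw [neg_div_natCast_add_one]
    linarith [div_natCast_add_one_nonneg (show 0 ≤ t - m by linarith) (numTies (m : Bid) x)]
  · linarith

lemma exists_coe_of_mem_Icc {a c : ℝ} {z : Bid} (h : z ∈ Icc (a : Bid) c) :
    ∃ m : ℝ, z = m ∧ a ≤ m ∧ m ≤ c := by
  rcases z with _ | m
  · exact absurd h.2 (not_le.2 (WithTop.coe_lt_top c))
  · exact ⟨m, rfl, WithTop.coe_le_coe.1 h.1, WithTop.coe_le_coe.1 h.2⟩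

/-- The bid `s` wins, alone or in a tie, at a price below `t`, whereas the truthful bid loses and
keeps `t`. The end `s` is included because even a share of a loss is a loss. -/
lemma rivalPayoff_lt_truthful_of_lt (hx : minRival x ∈ Ico (s : Bid) t) :
    rivalPayoff K η C t s x < rivalPayoff K η C t t x := by
  obtain ⟨m, h, hsm, -⟩ := exists_coe_of_mem_Icc ⟨hx.1, hx.2.le⟩
  have hmt : m < t := WithTop.coe_lt_coe.1 (h ▸ hx.2)
  rw [rivalPayoff_of_lt hx.2]
  rcases hsm.eq_or_lt with rfl | hsm
  · rw [rivalPayoff_of_eq h, neg_div_natCast_add_one]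
    linarith [div_natCast_add_one_pos (sub_pos.2 hmt) (numTies (s : Bid) x)]
  · rw [rivalPayoff_of_gt_coe h hsm]
    exact (min_le_right _ _).trans_lt hmt

lemma rivalPayoff_top_lt_truthful (hK : 2 ≤ K) (hη : η < 1) (hC : 0 < C) (ht : 0 ≤ t)
    (htC : t ≤ C) (hx : minRival x = ⊤ ∨ t < C ∧ (t : Bid) < minRival x) :
    rivalPayoff K η C t ⊤ x < rivalPayoff K η C t t x := by
  rcases h : minRival x with _ | m
  · rw [rivalPayoff_top h, rivalPayoff_of_gt_top h]
    exact refusal_payoff_lt hK hη hC ht htC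
  · rcases hx with hx | ⟨htC, hx⟩
    · rw [h] at hx; cases hx
    · have htm : t < m := WithTop.coe_lt_coe.1 (hx.trans_eq h)
      rw [rivalPayoff_of_lt (by rw [h]; exact WithTop.coe_lt_top m), rivalPayoff_of_gt_coe h htm]
      exact lt_min htC htm

variable [Nonempty ι]

/-- The truthful bid wins alone at a price above `t`. The end `s` is included because a tie there
shares the gain with at least one rival, hence the need for a nonempty set of rivals. -/
lemma rivalPayoff_lt_truthful_of_gt (hsC : s ≤ C) (hst : t < s)
    (hx : minRival x ∈ Ioc (t : Bid) s) :
    rivalPayoff K η C t s x < rivalPayoff K η C t t x := by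
  obtain ⟨m, h, -, hms⟩ := exists_coe_of_mem_Icc ⟨hx.1.le, hx.2⟩
  have hmt : t < m := WithTop.coe_lt_coe.1 (h ▸ hx.1)
  rw [rivalPayoff_of_gt_coe h hmt, min_eq_right (hms.trans hsC)]
  rcases hms.eq_or_lt with rfl | hms
  · rw [rivalPayoff_of_eq h]
    linarith [div_natCast_add_one_lt (sub_pos.2 hmt) (numTies_pos h)]
  · rwa [rivalPayoff_of_lt (by rw [h]; exact WithTop.coe_lt_coe.2 hms)]

/-- Winning below or at `C` is a loss for such a type. If the smallest rival bid is `C` itself,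
bidding `C` shares this loss with a rival, while `s` bears it alone. -/
lemma rivalPayoff_lt_reserve (htC : C < t) (hsC : s < C)
    (hx : minRival x ∈ Icc (s : Bid) C) :
    rivalPayoff K η C t s x < rivalPayoff K η C t C x := by
  obtain ⟨m, h, hsm, hmC⟩ := exists_coe_of_mem_Icc hx
  rcases hsm.eq_or_lt with rfl | hsm
  · rw [rivalPayoff_of_eq h, rivalPayoff_of_lt (by rw [h]; exact WithTop.coe_lt_coe.2 hsC),
      neg_div_natCast_add_one]
    linarith [div_natCast_add_one_pos (show 0 < t - s by linarith) (numTies (s : Bid) x)]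
  · rw [rivalPayoff_of_gt_coe h hsm, min_eq_right hmC]
    rcases hmC.eq_or_lt with rfl | hmC
    · rw [rivalPayoff_of_eq h, neg_div_natCast_add_one]
      linarith [div_natCast_add_one_lt (sub_pos.2 htC) (numTies_pos h)]
    · rw [rivalPayoff_of_lt (by rw [h]; exact WithTop.coe_lt_coe.2 hmC)]
      linarith

end Dominance

/-! ### Integrability of payoffs and independence of rival bids -/

section Measurability

variable {ι : Type*} [Fintype ι] {K : ℕ} {η C t : ℝ}

lemma measurable_minRival : Measurable (minRival : (ι → Bid) → Bid) := by
  have h : ∀ S : Finset ι, Measurable fun x : ι → Bid => S.inf x := by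
    classical
    intro S
    induction S using Finset.induction_on with
    | empty => simp
    | insert a S _ ih =>
      simp only [Finset.inf_insert]
      exact (measurable_pi_apply a).inf ih
  exact h _

lemma measurable_numTies (s : Bid) : Measurable fun x : ι → Bid => (numTies s x : ℝ) := by
  have h : (fun x : ι → Bid => (numTies s x : ℝ))
      = fun x => ∑ j, if x j = s then (1 : ℝ) else 0 := by
    ext x
    simp [numTies]
  rw [h]
  exact Finset.measurable_sum _ fun j _ =>
    Measurable.ite ((measurableSet_singleton s).preimage (measurable_pi_apply j))
      measurable_const measurable_const

lemma measurable_rivalPayoff (s : Bid) :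
    Measurable (rivalPayoff K η C t s : (ι → Bid) → ℝ) := by
  unfold rivalPayoff
  refine Measurable.ite (measurableSet_lt measurable_minRival measurable_const) measurable_const
    (Measurable.ite (MeasurableSet.const _) measurable_const
      (Measurable.ite (measurableSet_lt measurable_const measurable_minRival) ?_ ?_))
  · exact (measurable_minRival.const_inf _).untopD 0
  · have := measurable_numTies (ι := ι) s
    fun_prop

lemma abs_rivalPayoff_le (hC : 0 ≤ C) {s : Bid} (hs : s ∈ feasibleBids C) (x : ι → Bid) :
    |rivalPayoff K η C t s x| ≤ |t| + C + |((K : ℝ) - 1 + η) / (K : ℝ) * t| := by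
  have h1 := abs_nonneg t
  have h2 := abs_nonneg (((K : ℝ) - 1 + η) / (K : ℝ) * t)
  rcases hs with ⟨s, hs, rfl⟩ | rfl
  · rcases rivalPayoff_coe_cases (K := K) (η := η) (C := C) (t := t) s x with
      ⟨h, e⟩ | ⟨m, h, ⟨a, e⟩ | ⟨a, e⟩ | ⟨a, e⟩⟩ <;> simp only [e]
    · rw [abs_of_nonneg hC]; linarith
    · linarith
    · rw [abs_of_nonneg (le_min hC (hs.1.trans a.le))]
      linarith [min_le_left C m]
    · subst a
      set n : ℝ := (numTies (m : Bid) x : ℝ)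
      have hn0 : 0 ≤ n := Nat.cast_nonneg _
      -- In a tie the payoff is a convex combination of `t` and `m`.
      have e : t + (m - t) / (n + 1) = n / (n + 1) * t + 1 / (n + 1) * m := by
        field_simp; ring
      have h3 : n / (n + 1) ≤ 1 := by rw [div_le_one (by linarith)]; linarith
      have h4 : 1 / (n + 1) ≤ 1 := by rw [div_le_one (by linarith)]; linarith
      have h5 : 0 ≤ n / (n + 1) := by positivity
      have h6 : 0 ≤ 1 / (n + 1) := by positivity
      rw [e]
      refine (abs_add_le _ _).trans ?_
      rw [abs_mul, abs_mul, abs_of_nonneg h5, abs_of_nonneg h6, abs_of_nonneg hs.1]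
      nlinarith [hs.1, hs.2]
  · by_cases h : minRival x = ⊤
    · rw [rivalPayoff_top h]; linarith
    · rw [rivalPayoff_of_lt (lt_top_iff_ne_top.2 h)]; linarith

variable {μ : Measure ℝ} [IsProbabilityMeasure μ] {b : ℝ → Bid}

lemma aemeasurable_bids (hb : AEMeasurable b μ) :
    AEMeasurable (fun ρ : ι → ℝ => fun j => b (ρ j)) (Measure.pi fun _ => μ) :=
  aemeasurable_pi_iff.2 fun j =>
    hb.comp_quasiMeasurePreserving (Measure.quasiMeasurePreserving_eval (fun _ : ι => μ) j)

lemma integrable_rivalPayoff (hb : AEMeasurable b μ) (hC : 0 ≤ C) {s : Bid}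
    (hs : s ∈ feasibleBids C) :
    Integrable (fun ρ : ι → ℝ => rivalPayoff K η C t s fun j => b (ρ j))
      (Measure.pi fun _ => μ) :=
  Integrable.of_bound
    ((measurable_rivalPayoff s).comp_aemeasurable (aemeasurable_bids hb)).aestronglyMeasurable
    _ (Filter.Eventually.of_forall fun _ => abs_rivalPayoff_le hC hs _)

lemma ae_all_bids {p : Bid → Prop} (h : ∀ᵐ r ∂μ, p (b r)) :
    ∀ᵐ ρ : ι → ℝ ∂(Measure.pi fun _ => μ), ∀ j, p (b (ρ j)) :=
  Filter.eventually_all.2 fun j =>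
    (Measure.tendsto_eval_ae_ae (μ := fun _ : ι => μ) (i := j)).eventually h

/-- A bid set which all rivals avoid jointly is avoided by each of them. -/
lemma measure_preimage_eq_zero_of_ae {A : Set Bid}
    (h : ∀ᵐ ρ : ι → ℝ ∂(Measure.pi fun _ => μ), ¬ ∀ j, b (ρ j) ∈ A) : μ (b ⁻¹' A) = 0 := by
  have h1 : {ρ : ι → ℝ | ¬ ¬ ∀ j, b (ρ j) ∈ A} = Set.univ.pi fun _ => b ⁻¹' A := by
    ext ρ; simp
  -- By independence the box has measure `μ (b ⁻¹' A)` to the number of rivals; its sides need not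
  -- be measurable.
  rw [ae_iff, h1, Measure.pi_pi, Finset.prod_const] at h
  exact eq_zero_of_pow_eq_zero h

end Measurability

/-! ### From dominance to null sets of bids -/

section Expected

variable {K : ℕ} {η C t : ℝ} {μ : Measure ℝ} {b : ℝ → Bid} {k : Fin K}

lemma expectedPayoff_eq (s : Bid) :
    expectedPayoff μ η C b k t s =
      ∫ ρ, rivalPayoff K η C t s (fun j => b (ρ j)) ∂(Measure.pi fun _ : {j : Fin K // j ≠ k} => μ) := by
  simp only [expectedPayoff, payoff_bidProfile]

variable [IsProbabilityMeasure μ]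

lemma expectedPayoff_le (hb : AEMeasurable b μ) (hC : 0 ≤ C) {s s' : Bid}
    (hs : s ∈ feasibleBids C) (hs' : s' ∈ feasibleBids C)
    (h : ∀ᵐ ρ ∂(Measure.pi fun _ : {j : Fin K // j ≠ k} => μ),
      rivalPayoff K η C t s (fun j => b (ρ j)) ≤ rivalPayoff K η C t s' fun j => b (ρ j)) :
    expectedPayoff μ η C b k t s ≤ expectedPayoff μ η C b k t s' := by
  rw [expectedPayoff_eq, expectedPayoff_eq]
  exact integral_mono_ae (integrable_rivalPayoff hb hC hs) (integrable_rivalPayoff hb hC hs') h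

/-- A bid that is optimal although it is weakly dominated is never strictly dominated against
bids that the rivals use with positive probability. -/
lemma measure_preimage_eq_zero_of_dominated (hK : 2 ≤ K) (hb : AEMeasurable b μ) (hC : 0 ≤ C)
    {s s' : Bid} (hs : s ∈ feasibleBids C) (hs' : s' ∈ feasibleBids C)
    (hopt : expectedPayoff μ η C b k t s' ≤ expectedPayoff μ η C b k t s)
    (h : ∀ x : {j : Fin K // j ≠ k} → Bid, rivalPayoff K η C t s x ≤ rivalPayoff K η C t s' x)
    {A : Set Bid}
    (hA : ∀ x : {j : Fin K // j ≠ k} → Bid, minRival x ∈ A →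
      rivalPayoff K η C t s x < rivalPayoff K η C t s' x) :
    μ (b ⁻¹' A) = 0 := by
  have : Nontrivial (Fin K) := Fin.nontrivial_iff_two_le.2 hK
  have : Nonempty {j : Fin K // j ≠ k} := let ⟨j, hj⟩ := exists_ne k; ⟨⟨j, hj⟩⟩
  have h1 := expectedPayoff_le (t := t) (k := k) (η := η) hb hC hs hs'
    (Filter.Eventually.of_forall fun ρ => h _)
  have h2 := le_antisymm h1 hopt
  -- Ordered integrands with equal integrals agree almost everywhere, so the strict inequality on
  -- `A` can occur only on a null event.
  rw [expectedPayoff_eq, expectedPayoff_eq,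
    integral_eq_iff_of_ae_le (integrable_rivalPayoff hb hC hs) (integrable_rivalPayoff hb hC hs')
      (Filter.Eventually.of_forall fun ρ => h _)] at h2
  apply measure_preimage_eq_zero_of_ae (ι := {j : Fin K // j ≠ k})
  filter_upwards [h2] with ρ hρ hall
  exact (hA _ (minRival_mem hall)).ne hρ

end Expected

/-! ### The reserve rate against the refusal -/

section Threshold

variable {K : ℕ} {η C t p q : ℝ} {μ : Measure ℝ} {b : ℝ → Bid} {k : Fin K}

/-- The advantage of the reserve rate over the refusal for type `t`, when each rival bids the
reserve rate with probability `p` and refuses with probability `q`. -/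
def reserveAdvantage (K : ℕ) (η C p q t : ℝ) : ℝ :=
  ∑ n ∈ Finset.Icc 1 (K - 1),
      ((K - 1).choose n : ℝ) * p ^ n * q ^ (K - 1 - n) * ((C - t) / ((n : ℝ) + 1))
    + q ^ (K - 1) * (C - ((K : ℝ) - 1 + η) / (K : ℝ) * t)

lemma thresholdFun_eq (F : ℝ → ℝ) (r : ℝ) :
    thresholdFun K η F C r = reserveAdvantage K η C (F r - F C) (1 - F r) r := rfl

/-- The gain of the reserve rate over the refusal when `n` rivals bid the reserve rate and the
others refuse. -/
def tieAdvantage (K : ℕ) (η C t : ℝ) (n : ℕ) : ℝ :=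
  if n = 0 then C - ((K : ℝ) - 1 + η) / (K : ℝ) * t else (C - t) / ((n : ℝ) + 1)

lemma reserveAdvantage_eq_sum (hK : 2 ≤ K) :
    reserveAdvantage K η C p q t = ∑ n ∈ Finset.range (K - 1 + 1),
      (K - 1).choose n • (p ^ n * q ^ (K - 1 - n) * tieAdvantage K η C t n) := by
  have h : Finset.range (K - 1 + 1) = insert 0 (Finset.Icc 1 (K - 1)) := by
    ext n; simp; omega
  rw [h, Finset.sum_insert (by simp), reserveAdvantage, add_comm]
  congr 1
  · simp [tieAdvantage]
  · refine Finset.sum_congr rfl fun n hn => ?_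
    have : n ≠ 0 := by have := (Finset.mem_Icc.1 hn).1; omega
    rw [tieAdvantage, if_neg this, nsmul_eq_mul]
    ring

/-- The event that exactly the rivals in `S` bid `C` and the others refuse. -/
def tieEvent {ι : Type*} [DecidableEq ι] (b : ℝ → Bid) (C : ℝ) (S : Finset ι) : Set (ι → ℝ) :=
  {ρ | ∀ j, b (ρ j) = if j ∈ S then (C : Bid) else ⊤}

lemma measureReal_tieEvent {ι : Type*} [Fintype ι] [DecidableEq ι] [IsProbabilityMeasure μ]
    (S : Finset ι) :
    (Measure.pi fun _ : ι => μ).real (tieEvent b C S)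
      = μ.real (b ⁻¹' {(C : Bid)}) ^ S.card * μ.real (b ⁻¹' {⊤}) ^ (Fintype.card ι - S.card) := by
  have h : tieEvent b C S
      = Set.univ.pi fun j => if j ∈ S then b ⁻¹' {(C : Bid)} else b ⁻¹' {⊤} := by
    ext ρ
    simp only [tieEvent, mem_ofPred_eq, mem_pi, mem_univ, true_imp_iff]
    refine forall_congr' fun j => ?_
    split_ifs <;> simp
  rw [h, measureReal_def, Measure.pi_pi, ENNReal.toReal_prod,
    ← Finset.prod_mul_prod_compl S, ← Finset.card_compl]
  congr 1
  · rw [← Finset.prod_const]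
    exact Finset.prod_congr rfl fun j hj => by rw [if_pos hj]; rfl
  · rw [← Finset.prod_const]
    exact Finset.prod_congr rfl fun j hj => by rw [if_neg (Finset.mem_compl.1 hj)]; rfl

/-- If some rival bids below `C`, both bids lose and no tie event occurs. Otherwise exactly one tie
event occurs, namely that of the set of rivals bidding `C`. -/
lemma rivalPayoff_sub_eq_sum {ι : Type*} [Fintype ι] [DecidableEq ι] (ρ : ι → ℝ)
    (h : ∀ j, b (ρ j) < C ∨ b (ρ j) = C ∨ b (ρ j) = ⊤) :
    rivalPayoff K η C t C (fun j => b (ρ j)) - rivalPayoff K η C t ⊤ (fun j => b (ρ j))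
      = ∑ S : Finset ι, (tieEvent b C S).indicator (fun _ => tieAdvantage K η C t S.card) ρ := by
  by_cases hlt : ∃ j, b (ρ j) < C
  · obtain ⟨j, hj⟩ := hlt
    have hmin : minRival (fun j => b (ρ j)) < C :=
      (Finset.inf_le (f := fun j => b (ρ j)) (Finset.mem_univ j)).trans_lt hj
    rw [rivalPayoff_of_lt hmin, rivalPayoff_of_lt (hmin.trans (WithTop.coe_lt_top C)), sub_self]
    symm
    refine Finset.sum_eq_zero fun S _ => indicator_of_notMem (fun hS => ?_) _
    rw [hS j] at hj
    split_ifs at hj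
    · exact lt_irrefl _ hj
    · exact not_top_lt hj
  · push Not at hlt
    set T : Finset ι := Finset.univ.filter fun j => b (ρ j) = C with hT
    have hTtop : ∀ j, j ∉ T → b (ρ j) = ⊤ := fun j hj => by
      rcases h j with h | h | h
      · exact absurd h (not_lt.2 (hlt j))
      · exact absurd (by simp [hT, h]) hj
      · exact h
    have hTC : ∀ j, j ∈ T → b (ρ j) = C := fun j hj => by simpa [hT] using hj
    have hmem : ρ ∈ tieEvent b C T := fun j => by
      by_cases hj : j ∈ T
      · rw [if_pos hj, hTC j hj]
      · rw [if_neg hj, hTtop j hj]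
    have huniq : ∀ S : Finset ι, S ≠ T → ρ ∉ tieEvent b C S := fun S hS hρ => by
      refine hS (Finset.ext fun j => ?_)
      have h1 := (hρ j).symm.trans (hmem j)
      by_cases hjS : j ∈ S <;> by_cases hjT : j ∈ T <;> simp [hjS, hjT] at h1 ⊢
    rw [Finset.sum_eq_single T (fun S _ hS => indicator_of_notMem (huniq S hS) _) (by simp),
      indicator_of_mem hmem]
    have hties : numTies (C : Bid) (fun j => b (ρ j)) = T.card := rfl
    by_cases hT0 : T.card = 0
    · have hTe := Finset.card_eq_zero.1 hT0
      have hmin : minRival (fun j => b (ρ j)) = ⊤ := by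
        rw [minRival, Finset.inf_eq_top_iff]
        exact fun j _ => hTtop j (by simp [hTe])
      rw [rivalPayoff_of_gt_top hmin, rivalPayoff_top hmin, tieAdvantage, if_pos hT0]
    · obtain ⟨j, hj⟩ := Finset.card_ne_zero.1 hT0
      have hmin : minRival (fun j => b (ρ j)) = C := by
        refine le_antisymm ?_ (Finset.le_inf fun j _ => hlt j)
        rw [← hTC j hj]
        exact Finset.inf_le (f := fun j => b (ρ j)) (Finset.mem_univ j)
      rw [rivalPayoff_of_eq hmin, rivalPayoff_of_lt (by rw [hmin]; exact WithTop.coe_lt_top C),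
        hties, tieAdvantage, if_neg hT0]
      ring

lemma expectedPayoff_reserve_sub_top [IsProbabilityMeasure μ] (hK : 2 ≤ K) (hC : 0 ≤ C)
    (hb : AEMeasurable b μ) (h : ∀ᵐ r ∂μ, b r < C ∨ b r = C ∨ b r = ⊤) :
    expectedPayoff μ η C b k t C - expectedPayoff μ η C b k t ⊤
      = reserveAdvantage K η C (μ.real (b ⁻¹' {(C : Bid)})) (μ.real (b ⁻¹' {⊤})) t := by
  classical
  have hmeas : ∀ S : Finset {j : Fin K // j ≠ k},
      NullMeasurableSet (tieEvent b C S) (Measure.pi fun _ : {j : Fin K // j ≠ k} => μ) := by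
    intro S
    have := (aemeasurable_bids (ι := {j : Fin K // j ≠ k}) hb).nullMeasurableSet_preimage
      (measurableSet_singleton fun j => if j ∈ S then (C : Bid) else ⊤)
    convert this using 1
    ext ρ
    simp [tieEvent, funext_iff]
  have hcard : Fintype.card {j : Fin K // j ≠ k} = K - 1 := by
    simp [Fintype.card_subtype_compl]
  rw [expectedPayoff_eq, expectedPayoff_eq, ← integral_sub
    (integrable_rivalPayoff hb hC (Or.inl ⟨C, ⟨hC, le_rfl⟩, rfl⟩))
    (integrable_rivalPayoff hb hC (Or.inr rfl))]
  have hae := ae_all_bids (ι := {j : Fin K // j ≠ k})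
    (p := fun z => z < C ∨ z = C ∨ z = ⊤) h
  rw [integral_congr_ae (hae.mono fun ρ hρ => rivalPayoff_sub_eq_sum ρ hρ),
    integral_finsetSum _ fun S _ => (integrable_const _).indicator₀ (hmeas S)]
  simp only [integral_indicator₀ (hmeas _), setIntegral_const, smul_eq_mul, measureReal_tieEvent,
    hcard]
  -- The summand depends on `S` only through its size, so grouping by size produces the binomial
  -- coefficients.
  rw [reserveAdvantage_eq_sum hK, ← hcard, ← Finset.card_univ, ← Finset.sum_powerset_apply_card
    (fun n => μ.real (b ⁻¹' {(C : Bid)}) ^ n * μ.real (b ⁻¹' {⊤}) ^ (Finset.univ.card - n)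
      * tieAdvantage K η C t n), Finset.powerset_univ]

end Threshold

/-! ### Almost no value of a map borders a gap in its distribution -/

section Gaps

variable {X α : Type*} [MeasurableSpace X] [LinearOrder α] [TopologicalSpace α] [OrderTopology α]
  [DenselyOrdered α] [TopologicalSpace.SeparableSpace α] (μ : Measure X) (b : X → α)

/-- The left ends `z` of gaps reaching up to `q` are themselves swallowed by such gaps: by the
largest one if it exists, and otherwise by countably many whose left ends lie in a dense set. -/
lemma measure_preimage_gap_below (q : α) :
    μ (b ⁻¹' {z | z < q ∧ μ (b ⁻¹' Ico z q) = 0}) = 0 := by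
  set Z : Set α := {z | z < q ∧ μ (b ⁻¹' Ico z q) = 0}
  by_cases hmin : ∃ z ∈ Z, ∀ z' ∈ Z, z ≤ z'
  · obtain ⟨z, hz, hle⟩ := hmin
    exact measure_mono_null (fun r (hr : b r ∈ Z) => (⟨hle _ hr, hr.1⟩ : b r ∈ Ico z q)) hz.2
  · push Not at hmin
    obtain ⟨D, hDc, hD⟩ := TopologicalSpace.exists_countable_dense α
    have hsub : b ⁻¹' Z ⊆ ⋃ d ∈ D ∩ Z, b ⁻¹' Ico d q := fun r (hr : b r ∈ Z) => by
      obtain ⟨z', hz', hlt⟩ := hmin _ hr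
      obtain ⟨d, hd, h1, h2⟩ := hD.exists_between hlt
      have hdZ : d ∈ Z := ⟨h2.trans hr.1,
        measure_mono_null (preimage_mono (Ico_subset_Ico_left h1.le)) hz'.2⟩
      exact mem_biUnion (x := d) ⟨hd, hdZ⟩ ⟨h2.le, hr.1⟩
    exact measure_mono_null hsub
      ((measure_biUnion_null_iff (hDc.mono inter_subset_left)).2 fun d hd => hd.2.2)

/-- Almost every value of `b` has values of `b` immediately above it, or is an atom. -/
lemma ae_measure_Ico_ne_zero : ∀ᵐ r ∂μ, ∀ q, b r < q → μ (b ⁻¹' Ico (b r) q) ≠ 0 := by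
  obtain ⟨D, hDc, hD⟩ := TopologicalSpace.exists_countable_dense α
  have h : ∀ᵐ r ∂μ, ∀ d ∈ D, ¬ (b r < d ∧ μ (b ⁻¹' Ico (b r) d) = 0) :=
    (ae_ball_iff hDc).2 fun d _ => by
      rw [ae_iff]
      simp only [not_not]
      exact measure_preimage_gap_below μ b d
  filter_upwards [h] with r hr q hq h0
  obtain ⟨d, hd, h1, h2⟩ := hD.exists_between hq
  exact hr d hd ⟨h1, measure_mono_null (preimage_mono (Ico_subset_Ico_right h2.le)) h0⟩

/-- Almost every value of `b` has values of `b` immediately below it, or is an atom. -/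
lemma ae_measure_Ioc_ne_zero : ∀ᵐ r ∂μ, ∀ q, q < b r → μ (b ⁻¹' Ioc q (b r)) ≠ 0 := by
  -- Reversing the order turns gaps above a value into gaps below it.
  filter_upwards [ae_measure_Ico_ne_zero μ (fun r => OrderDual.toDual (b r))] with r hr q hq h0
  refine hr (OrderDual.toDual q) hq (measure_mono_null (fun r' hr' => ?_) h0)
  exact ⟨hr'.2, hr'.1⟩

end Gaps

/-! ### The law of the types -/

section TypeLaw

variable {rmin rmax : ℝ} {f : ℝ → ℝ}

lemma isProbabilityMeasure_typeLaw
    (hf_int : ∫⁻ r in Icc rmin rmax, ENNReal.ofReal (f r) = 1) :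
    IsProbabilityMeasure (typeLaw rmin rmax f) :=
  ⟨by rw [typeLaw, withDensity_apply _ MeasurableSet.univ, Measure.restrict_univ, hf_int]⟩

lemma nullSingletonClass_typeLaw : NullSingletonClass (typeLaw rmin rmax f) :=
  ⟨fun x => (withDensity_absolutelyContinuous _ _) (measure_singleton x)⟩

lemma ae_mem_Icc_typeLaw : ∀ᵐ r ∂typeLaw rmin rmax f, r ∈ Icc rmin rmax :=
  (withDensity_absolutelyContinuous _ _).ae_le (ae_restrict_mem measurableSet_Icc)

lemma typeLaw_Ioo_ne_zero (hf_meas : Measurable f) (hf_pos : ∀ r ∈ Icc rmin rmax, 0 < f r)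
    {a c : ℝ} (hac : a < c) (ha : rmin ≤ a) (hc : c ≤ rmax) :
    typeLaw rmin rmax f (Ioo a c) ≠ 0 := by
  have hsub : Ioo a c ⊆ Icc rmin rmax := fun r hr => ⟨ha.trans hr.1.le, hr.2.le.trans hc⟩
  rw [typeLaw, withDensity_apply _ measurableSet_Ioo, Measure.restrict_restrict measurableSet_Ioo,
    inter_eq_left.2 hsub]
  intro h0
  rw [setLIntegral_eq_zero_iff measurableSet_Ioo hf_meas.ennreal_ofReal] at h0
  have h1 : volume (Ioo a c) = 0 := by
    refine measure_mono_null (fun r hr => ?_) (ae_iff.1 h0)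
    simp only [mem_ofPred_eq]
    intro h2
    exact absurd (h2 hr) (ENNReal.ofReal_pos.2 (hf_pos r (hsub hr))).ne'
  rw [Real.volume_Ioo, ENNReal.ofReal_eq_zero] at h1
  linarith

/-- An almost sure property of types holds for some type in every interval. -/
lemma exists_mem_Ioo_of_ae (hf_meas : Measurable f)
    (hf_pos : ∀ r ∈ Icc rmin rmax, 0 < f r) {p : ℝ → Prop}
    (hp : ∀ᵐ r ∂typeLaw rmin rmax f, p r) {a c : ℝ} (hac : a < c) (ha : rmin ≤ a)
    (hc : c ≤ rmax) : ∃ r ∈ Ioo a c, p r := by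
  by_contra! hno
  exact typeLaw_Ioo_ne_zero hf_meas hf_pos hac ha hc (measure_mono_null hno (ae_iff.1 hp))

end TypeLaw

/-! ### Monotonicity and sign of the advantage of the reserve rate -/

section Advantage

variable {K : ℕ} {η C p q : ℝ}

lemma reserveAdvantage_term_antitone {n : ℕ} {t t' c : ℝ} (hc : 0 ≤ c) (htt : t ≤ t') :
    c * ((C - t') / ((n : ℝ) + 1)) ≤ c * ((C - t) / ((n : ℝ) + 1)) := by
  gcongr

lemma antitone_reserveAdvantage (hK : 2 ≤ K) (hη : 0 < η) (hp : 0 ≤ p) (hq : 0 ≤ q) :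
    Antitone (reserveAdvantage K η C p q) := fun t t' htt => by
  have := refusal_factor_pos hK hη
  refine add_le_add (Finset.sum_le_sum fun n _ =>
    reserveAdvantage_term_antitone (by positivity) htt) ?_
  gcongr

/-- The strictness comes from the event that all rivals refuse, which has positive weight when `q >
0`. -/
lemma strictAnti_reserveAdvantage (hK : 2 ≤ K) (hη : 0 < η) (hp : 0 ≤ p) (hq : 0 < q) :
    StrictAnti (reserveAdvantage K η C p q) := fun t t' htt => by
  have := refusal_factor_pos hK hη
  refine add_lt_add_of_le_of_lt (Finset.sum_le_sum fun n _ =>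
    reserveAdvantage_term_antitone (by positivity) htt.le) ?_
  gcongr

lemma continuous_reserveAdvantage : Continuous (reserveAdvantage K η C p q) := by
  unfold reserveAdvantage
  fun_prop

/-- At `t = C` a tie brings no surplus, so only the event that all rivals refuse contributes. -/
lemma reserveAdvantage_reserve_pos (hK : 2 ≤ K) (hη : η < 1) (hC : 0 < C) (hq : 0 < q) :
    0 < reserveAdvantage K η C p q C := by
  have := refusal_payoff_lt hK hη hC hC.le le_rfl
  simp only [reserveAdvantage, sub_self, zero_div, mul_zero, Finset.sum_const_zero, zero_add]
  exact mul_pos (pow_pos hq _) (by linarith)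

lemma reserveAdvantage_neg_of_no_refusal {t : ℝ} (hK : 2 ≤ K) (hp : 0 < p) (ht : C < t) :
    reserveAdvantage K η C p 0 t < 0 := by
  rw [reserveAdvantage, zero_pow (by omega), zero_mul, add_zero]
  -- The term `n = K - 1` is the one in which `q = 0` has exponent zero, so it does not vanish.
  refine Finset.sum_neg' (fun n _ => ?_) ⟨K - 1, Finset.mem_Icc.2 ⟨by omega, le_rfl⟩, ?_⟩
  · exact mul_nonpos_of_nonneg_of_nonpos (by positivity)
      (div_nonpos_of_nonpos_of_nonneg (by linarith) (by positivity))
  · rw [Nat.choose_self, Nat.sub_self, pow_zero, Nat.cast_one, one_mul, mul_one]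
    exact mul_neg_of_pos_of_neg (by positivity)
      (div_neg_of_neg_of_pos (by linarith) (by positivity))

lemma reserveAdvantage_of_no_reserve {t : ℝ} :
    reserveAdvantage K η C 0 q t = q ^ (K - 1) * (C - ((K : ℝ) - 1 + η) / (K : ℝ) * t) := by
  rw [reserveAdvantage, Finset.sum_eq_zero, zero_add]
  intro n hn
  have := (Finset.mem_Icc.1 hn).1
  rw [zero_pow (by omega)]
  ring

end Advantage

/-! ### Bid probabilities under the three-region form -/

section Region

variable {rmin rmax C rT : ℝ} {b : ℝ → Bid} {μ : Measure ℝ}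

lemma HasThreeRegionForm.ae_eq [NullSingletonClass μ] (h : HasThreeRegionForm rmin rmax C rT b)
    (hμ : ∀ᵐ r ∂μ, r ∈ Icc rmin rmax) :
    b =ᵐ[μ] fun r => if r ≤ C then (r : Bid) else if r ≤ rT then (C : Bid) else ⊤ := by
  filter_upwards [hμ, Measure.ae_ne μ rmin, Measure.ae_ne μ rT] with r hr h1 h2
  by_cases hC : r ≤ C
  · rw [if_pos hC, h.truthful r ⟨lt_of_le_of_ne hr.1 h1.symm, hC⟩]
  · rw [if_neg hC]
    by_cases hT : r ≤ rT
    · rw [if_pos hT, h.reserve r ⟨not_le.1 hC, lt_of_le_of_ne hT h2⟩]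
    · rw [if_neg hT, h.refuse r ⟨not_le.1 hT, hr.2⟩]

lemma HasThreeRegionForm.aemeasurable [NullSingletonClass μ] (h : HasThreeRegionForm rmin rmax C rT b)
    (hμ : ∀ᵐ r ∂μ, r ∈ Icc rmin rmax) : AEMeasurable b μ :=
  ⟨_, Measurable.ite measurableSet_Iic WithTop.measurable_coe
    (Measurable.ite measurableSet_Iic measurable_const measurable_const), h.ae_eq hμ⟩

variable [IsProbabilityMeasure μ] [NullSingletonClass μ]

lemma HasThreeRegionForm.measureReal_reserve (h : HasThreeRegionForm rmin rmax C rT b)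
    (hμ : ∀ᵐ r ∂μ, r ∈ Icc rmin rmax) (hT : C ≤ rT) :
    μ.real (b ⁻¹' {(C : Bid)}) = ProbabilityTheory.cdf μ rT - ProbabilityTheory.cdf μ C := by
  rw [ProbabilityTheory.cdf_eq_real, ProbabilityTheory.cdf_eq_real,
    ← measureReal_sdiff (Iic_subset_Iic.2 hT) measurableSet_Iic]
  refine measureReal_congr ?_
  -- The type `C` may bid `C` as well, without belonging to `(C, rT]`; it is discarded as a null
  -- set.
  filter_upwards [h.ae_eq hμ, Measure.ae_ne μ C] with r hr hne
  refine propext (show b r = C ↔ r ≤ rT ∧ ¬ r ≤ C from ?_)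
  rw [hr]
  by_cases h1 : r ≤ C
  · simp [h1, hne]
  · by_cases h2 : r ≤ rT <;> simp [h1, h2]

lemma HasThreeRegionForm.measureReal_refuse (h : HasThreeRegionForm rmin rmax C rT b)
    (hμ : ∀ᵐ r ∂μ, r ∈ Icc rmin rmax) (hT : C ≤ rT) :
    μ.real (b ⁻¹' {⊤}) = 1 - ProbabilityTheory.cdf μ rT := by
  rw [ProbabilityTheory.cdf_eq_real, ← probReal_compl_eq_one_sub measurableSet_Iic]
  refine measureReal_congr ?_
  filter_upwards [h.ae_eq hμ] with r hr
  refine propext (show b r = ⊤ ↔ ¬ r ≤ rT from ?_)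
  rw [hr]
  by_cases h1 : r ≤ C
  · simp [h1, h1.trans hT]
  · by_cases h2 : r ≤ rT <;> simp [h1, h2]

end Region

lemma coe_mem_feasibleBids {C s : ℝ} (h0 : 0 ≤ s) (hs : s ≤ C) : (s : Bid) ∈ feasibleBids C :=
  Or.inl ⟨s, ⟨h0, hs⟩, rfl⟩

lemma top_mem_feasibleBids {C : ℝ} : (⊤ : Bid) ∈ feasibleBids C := Or.inr rfl

lemma feasibleBids_cases {C : ℝ} {z : Bid} (h : z ∈ feasibleBids C) :
    z = ⊤ ∨ ∃ s : ℝ, z = s ∧ 0 ≤ s ∧ s ≤ C := by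
  rcases h with ⟨s, hs, rfl⟩ | rfl
  · exact Or.inr ⟨s, rfl, hs.1, hs.2⟩
  · exact Or.inl rfl

lemma lt_or_eq_or_top_of_mem_feasibleBids {C : ℝ} {z : Bid} (h : z ∈ feasibleBids C) :
    z < C ∨ z = C ∨ z = ⊤ := by
  rcases feasibleBids_cases h with h | ⟨s, rfl, -, hs⟩
  · exact Or.inr (Or.inr h)
  · rcases hs.lt_or_eq with hs | rfl
    · exact Or.inl (WithTop.coe_lt_coe.2 hs)
    · exact Or.inr (Or.inl rfl)

/-! ### Necessity: the shape of an equilibrium -/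

namespace IsSBNE

variable {K : ℕ} {η rmin rmax C t s : ℝ} {f : ℝ → ℝ} {b : ℝ → Bid}

lemma ae_lt_or_eq_or_top (h : IsSBNE K η rmin rmax f C b) :
    ∀ᵐ r ∂typeLaw rmin rmax f, b r < C ∨ b r = C ∨ b r = ⊤ :=
  ae_mem_Icc_typeLaw.mono fun r hr => lt_or_eq_or_top_of_mem_feasibleBids (h.feasible r hr)

variable [IsProbabilityMeasure (typeLaw rmin rmax f)]

lemma underbid_gap (h : IsSBNE K η rmin rmax f C b) (hK : 2 ≤ K) (hrmin : 0 ≤ rmin)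
    (ht : t ∈ Icc rmin rmax) (htC : t ≤ C) (hbt : b t < t) :
    typeLaw rmin rmax f (b ⁻¹' Ico (b t) t) = 0 := by
  rcases feasibleBids_cases (h.feasible t ht) with hs | ⟨s, hs, h0, hsC⟩
  · rw [hs] at hbt; exact absurd hbt not_top_lt
  have h1 := h.optimal ⟨0, by omega⟩ t ht t (coe_mem_feasibleBids (hrmin.trans ht.1) htC)
  rw [hs] at h1 ⊢
  exact measure_preimage_eq_zero_of_dominated hK h.measurable (h0.trans hsC)
    (coe_mem_feasibleBids h0 hsC) (coe_mem_feasibleBids (hrmin.trans ht.1) htC) h1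
    (fun x => rivalPayoff_le_truthful htC hsC) fun x hx => rivalPayoff_lt_truthful_of_lt hx

lemma overbid_gap (h : IsSBNE K η rmin rmax f C b) (hK : 2 ≤ K) (hη : η < 1) (hC : 0 < C)
    (hrmin : 0 ≤ rmin) (ht : t ∈ Icc rmin rmax) (htC : t < C) (hbt : (t : Bid) < b t) :
    typeLaw rmin rmax f (b ⁻¹' Ioc (t : Bid) (b t)) = 0 := by
  have h1 := h.optimal ⟨0, by omega⟩ t ht t (coe_mem_feasibleBids (hrmin.trans ht.1) htC.le)
  rcases feasibleBids_cases (h.feasible t ht) with hs | ⟨s, hs, h0, hsC⟩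
  · rw [hs] at h1 ⊢
    exact measure_preimage_eq_zero_of_dominated hK h.measurable hC.le
      top_mem_feasibleBids (coe_mem_feasibleBids (hrmin.trans ht.1) htC.le) h1
      (fun x => rivalPayoff_top_le_truthful hK hη hC (hrmin.trans ht.1) htC.le)
      fun x hx => rivalPayoff_top_lt_truthful hK hη hC (hrmin.trans ht.1) htC.le
        (Or.inr ⟨htC, hx.1⟩)
  · have : Nontrivial (Fin K) := Fin.nontrivial_iff_two_le.2 hK
    have : Nonempty {j : Fin K // j ≠ ⟨0, by omega⟩} :=
      let ⟨j, hj⟩ := exists_ne (⟨0, by omega⟩ : Fin K); ⟨⟨j, hj⟩⟩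
    rw [hs] at h1 hbt ⊢
    exact measure_preimage_eq_zero_of_dominated hK h.measurable hC.le
      (coe_mem_feasibleBids h0 hsC) (coe_mem_feasibleBids (hrmin.trans ht.1) htC.le) h1
      (fun x => rivalPayoff_le_truthful htC.le hsC)
      fun x hx => rivalPayoff_lt_truthful_of_gt hsC (WithTop.coe_lt_coe.1 hbt) hx

lemma refusal_null_of_low_refusal (h : IsSBNE K η rmin rmax f C b) (hK : 2 ≤ K) (hη : η < 1)
    (hC : 0 < C) (hrmin : 0 ≤ rmin) (ht : t ∈ Icc rmin rmax) (htC : t ≤ C) (hbt : b t = ⊤) :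
    typeLaw rmin rmax f (b ⁻¹' {⊤}) = 0 := by
  have h1 := h.optimal ⟨0, by omega⟩ t ht t (coe_mem_feasibleBids (hrmin.trans ht.1) htC)
  rw [hbt] at h1
  exact measure_preimage_eq_zero_of_dominated hK h.measurable hC.le
    top_mem_feasibleBids (coe_mem_feasibleBids (hrmin.trans ht.1) htC) h1
    (fun x => rivalPayoff_top_le_truthful hK hη hC (hrmin.trans ht.1) htC)
    fun x hx => rivalPayoff_top_lt_truthful hK hη hC (hrmin.trans ht.1) htC (Or.inl hx)

lemma high_underbid_gap (h : IsSBNE K η rmin rmax f C b) (hK : 2 ≤ K) (hC : 0 < C)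
    (ht : t ∈ Icc rmin rmax) (htC : C < t) (hbt : b t < C) :
    typeLaw rmin rmax f (b ⁻¹' Icc (b t) C) = 0 := by
  rcases feasibleBids_cases (h.feasible t ht) with hs | ⟨s, hs, h0, hsC⟩
  · rw [hs] at hbt; exact absurd hbt not_top_lt
  have : Nontrivial (Fin K) := Fin.nontrivial_iff_two_le.2 hK
  have : Nonempty {j : Fin K // j ≠ ⟨0, by omega⟩} :=
    let ⟨j, hj⟩ := exists_ne (⟨0, by omega⟩ : Fin K); ⟨⟨j, hj⟩⟩
  have h1 := h.optimal ⟨0, by omega⟩ t ht C (coe_mem_feasibleBids hC.le le_rfl)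
  rw [hs] at h1 hbt ⊢
  exact measure_preimage_eq_zero_of_dominated hK h.measurable hC.le
    (coe_mem_feasibleBids h0 hsC) (coe_mem_feasibleBids hC.le le_rfl) h1
    (fun x => rivalPayoff_le_reserve htC.le hsC)
    fun x hx => rivalPayoff_lt_reserve htC (WithTop.coe_lt_coe.1 hbt) hx

/-- A non-truthful type borders a gap that starts or ends at its own bid, and almost no type does.
-/
lemma ae_truthful (h : IsSBNE K η rmin rmax f C b) (hK : 2 ≤ K) (hη : η < 1) (hC : 0 < C)
    (hrmin : 0 ≤ rmin) : ∀ᵐ r ∂typeLaw rmin rmax f, r < C → b r = r := by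
  filter_upwards [ae_mem_Icc_typeLaw, ae_measure_Ico_ne_zero (typeLaw rmin rmax f) b,
    ae_measure_Ioc_ne_zero (typeLaw rmin rmax f) b] with r hr h1 h2 hrC
  rcases lt_trichotomy (b r) r with hlt | heq | hgt
  · exact absurd (h.underbid_gap hK hrmin hr hrC.le hlt) (h1 _ hlt)
  · exact heq
  · exact absurd (h.overbid_gap hK hη hC hrmin hr hrC hgt) (h2 _ hgt)

lemma ae_high (h : IsSBNE K η rmin rmax f C b) (hK : 2 ≤ K) (hC : 0 < C) :
    ∀ᵐ r ∂typeLaw rmin rmax f, C < r → b r = C ∨ b r = ⊤ := by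
  filter_upwards [ae_mem_Icc_typeLaw, ae_measure_Ico_ne_zero (typeLaw rmin rmax f) b]
    with r hr h1 hrC
  rcases lt_or_eq_or_top_of_mem_feasibleBids (h.feasible r hr) with hlt | heq
  · exact absurd (measure_mono_null (preimage_mono Ico_subset_Icc_self)
      (h.high_underbid_gap hK hC hr hrC hlt)) (h1 _ hlt)
  · exact heq

/-- The advantage of the reserve rate over the refusal in the equilibrium `b`. -/
abbrev advantage (K : ℕ) (η rmin rmax : ℝ) (f : ℝ → ℝ) (C : ℝ) (b : ℝ → Bid) (t : ℝ) : ℝ :=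
  reserveAdvantage K η C ((typeLaw rmin rmax f).real (b ⁻¹' {(C : Bid)}))
    ((typeLaw rmin rmax f).real (b ⁻¹' {⊤})) t

lemma advantage_nonneg (h : IsSBNE K η rmin rmax f C b) (hK : 2 ≤ K) (hC : 0 < C)
    (ht : t ∈ Icc rmin rmax) (hbt : b t = C) : 0 ≤ advantage K η rmin rmax f C b t := by
  have h1 := h.optimal ⟨0, by omega⟩ t ht ⊤ top_mem_feasibleBids
  rw [hbt] at h1
  rw [advantage, ← expectedPayoff_reserve_sub_top (k := ⟨0, by omega⟩) hK hC.le h.measurable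
    h.ae_lt_or_eq_or_top]
  exact sub_nonneg.2 h1

lemma advantage_nonpos (h : IsSBNE K η rmin rmax f C b) (hK : 2 ≤ K) (hC : 0 < C)
    (ht : t ∈ Icc rmin rmax) (hbt : b t = ⊤) : advantage K η rmin rmax f C b t ≤ 0 := by
  have h1 := h.optimal ⟨0, by omega⟩ t ht C (coe_mem_feasibleBids hC.le le_rfl)
  rw [hbt] at h1
  rw [advantage, ← expectedPayoff_reserve_sub_top (k := ⟨0, by omega⟩) hK hC.le h.measurable
    h.ae_lt_or_eq_or_top]
  exact sub_nonpos.2 h1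

/-- If almost nobody refused, almost all types above `C` would bid `C`. Such a type would then only
ever win at a loss, and refusing would be strictly better. -/
lemma refusal_pos (h : IsSBNE K η rmin rmax f C b) (hK : 2 ≤ K) (hf_meas : Measurable f)
    (hf_pos : ∀ r ∈ Icc rmin rmax, 0 < f r) (hC : C ∈ Ico rmin rmax) (hC_pos : 0 < C) :
    0 < (typeLaw rmin rmax f).real (b ⁻¹' {⊤}) := by
  refine lt_of_le_of_ne measureReal_nonneg fun h0 => ?_
  have htop : ∀ᵐ r ∂typeLaw rmin rmax f, b r ≠ ⊤ :=
    measure_eq_zero_iff_ae_notMem.1 ((measureReal_eq_zero_iff).1 h0.symm)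
  have hres : ∀ᵐ r ∂typeLaw rmin rmax f, C < r → b r = C := by
    filter_upwards [htop, h.ae_high hK hC_pos] with r h1 h2 h3
    exact (h2 h3).resolve_right h1
  have hp : 0 < (typeLaw rmin rmax f).real (b ⁻¹' {(C : Bid)}) := by
    refine lt_of_le_of_ne measureReal_nonneg fun hp0 => ?_
    have hne : ∀ᵐ r ∂typeLaw rmin rmax f, b r ≠ C :=
      measure_eq_zero_iff_ae_notMem.1 ((measureReal_eq_zero_iff).1 hp0.symm)
    obtain ⟨r, hr, h1, h2⟩ := exists_mem_Ioo_of_ae hf_meas hf_pos (hres.and hne) hC.2 hC.1 le_rfl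
    exact h2 (h1 hr.1)
  obtain ⟨r, hr, h1⟩ := exists_mem_Ioo_of_ae hf_meas hf_pos hres hC.2 hC.1 le_rfl
  have h2 := h.advantage_nonneg hK hC_pos ⟨hC.1.trans hr.1.le, hr.2.le⟩ (h1 hr.1)
  rw [advantage, ← h0] at h2
  exact absurd (reserveAdvantage_neg_of_no_refusal hK hp hr.1) (not_lt.2 h2)

/-- If almost nobody bid `C`, almost all types just above `C` would refuse, although `C` would win
against unanimous refusal and pay more than the refusal does. -/
lemma reserve_pos (h : IsSBNE K η rmin rmax f C b) (hK : 2 ≤ K) (hη : η ∈ Ioo (0 : ℝ) 1)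
    (hf_meas : Measurable f)
    (hf_pos : ∀ r ∈ Icc rmin rmax, 0 < f r) (hC : C ∈ Ico rmin rmax) (hC_pos : 0 < C) :
    0 < (typeLaw rmin rmax f).real (b ⁻¹' {(C : Bid)}) := by
  refine lt_of_le_of_ne measureReal_nonneg fun h0 => ?_
  have hq := h.refusal_pos hK hf_meas hf_pos hC hC_pos
  have hne : ∀ᵐ r ∂typeLaw rmin rmax f, b r ≠ C :=
    measure_eq_zero_iff_ae_notMem.1 ((measureReal_eq_zero_iff).1 h0.symm)
  have hl0 := refusal_factor_pos hK hη.1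
  have hl1 := refusal_factor_lt_one hK hη.2
  -- The right-hand side is the type that is indifferent between being paid `C` and a unanimous
  -- refusal.
  have hCl : C < C / (((K : ℝ) - 1 + η) / (K : ℝ)) := by
    rw [lt_div_iff₀ hl0]; nlinarith
  obtain ⟨r, hr, h1, h2⟩ := exists_mem_Ioo_of_ae hf_meas hf_pos
    (hne.and (h.ae_high hK hC_pos)) (lt_min hC.2 hCl) hC.1 (min_le_left _ _)
  have hr1 := hr.2.trans_le (min_le_left _ _)
  have hr2 := hr.2.trans_le (min_le_right _ _)
  rw [lt_div_iff₀ hl0] at hr2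
  have h3 := h.advantage_nonpos hK hC_pos ⟨hC.1.trans hr.1.le, hr1.le⟩
    ((h2 hr.1).resolve_left h1)
  rw [advantage, ← h0, reserveAdvantage_of_no_reserve] at h3
  exact absurd (mul_pos (pow_pos hq (K - 1))
    (show 0 < C - ((K : ℝ) - 1 + η) / (K : ℝ) * r by linarith)) (not_lt.2 h3)

/-- Holds for every type, because the gap of a lower bid would contain the atom `C`. -/
lemma reserve_or_refuse (h : IsSBNE K η rmin rmax f C b) (hK : 2 ≤ K) (hC : 0 < C)
    (hp : 0 < (typeLaw rmin rmax f).real (b ⁻¹' {(C : Bid)}))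
    (ht : t ∈ Icc rmin rmax) (htC : C < t) : b t = C ∨ b t = ⊤ := by
  rcases lt_or_eq_or_top_of_mem_feasibleBids (h.feasible t ht) with hlt | heq
  · refine absurd ((measureReal_eq_zero_iff).2 (measure_mono_null (preimage_mono ?_)
      (h.high_underbid_gap hK hC ht htC hlt))) hp.ne'
    exact singleton_subset_iff.2 ⟨hlt.le, le_rfl⟩
  · exact heq

lemma not_overbid (h : IsSBNE K η rmin rmax f C b) (hK : 2 ≤ K) (hη : η < 1)
    (hrmin : 0 ≤ rmin) (hf_meas : Measurable f)
    (hf_pos : ∀ r ∈ Icc rmin rmax, 0 < f r) (hC : C ∈ Ico rmin rmax) (hC_pos : 0 < C)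
    (hq : 0 < (typeLaw rmin rmax f).real (b ⁻¹' {⊤}))
    (ht : rmin ≤ t) (htC : t ≤ C) : b t ≤ t := by
  by_contra! hgt
  have ht' : t ∈ Icc rmin rmax := ⟨ht, htC.trans hC.2.le⟩
  rcases feasibleBids_cases (h.feasible t ht') with hs | ⟨s, hs, h0, hsC⟩
  · exact hq.ne' ((measureReal_eq_zero_iff).2
      (h.refusal_null_of_low_refusal hK hη hC_pos hrmin ht' htC hs))
  · rw [hs] at hgt
    have hts := WithTop.coe_lt_coe.1 hgt
    -- The gap of an overbid `s` contains the bids of the almost surely truthful types in `(t, s)`.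
    have h1 := h.overbid_gap hK hη hC_pos hrmin ht' (hts.trans_le hsC) (hs ▸ hgt)
    obtain ⟨r, hr, h2, h3⟩ := exists_mem_Ioo_of_ae hf_meas hf_pos
      ((h.ae_truthful hK hη hC_pos hrmin).and (measure_eq_zero_iff_ae_notMem.1 h1)) hts ht
      (hsC.trans hC.2.le)
    refine h3 ?_
    rw [mem_preimage, h2 (hr.2.trans_le hsC), hs]
    exact ⟨WithTop.coe_lt_coe.2 hr.1, WithTop.coe_le_coe.2 hr.2.le⟩

lemma truthful (h : IsSBNE K η rmin rmax f C b) (hK : 2 ≤ K) (hη : η < 1)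
    (hrmin : 0 ≤ rmin) (hf_meas : Measurable f)
    (hf_pos : ∀ r ∈ Icc rmin rmax, 0 < f r) (hC : C ∈ Ico rmin rmax) (hC_pos : 0 < C)
    (hq : 0 < (typeLaw rmin rmax f).real (b ⁻¹' {⊤})) (ht : t ∈ Ioc rmin C) : b t = t := by
  have ht' : t ∈ Icc rmin rmax := ⟨ht.1.le, ht.2.trans hC.2.le⟩
  refine (h.not_overbid hK hη hrmin hf_meas hf_pos hC hC_pos hq ht.1.le ht.2).eq_of_not_lt
    fun hlt => ?_
  rcases feasibleBids_cases (h.feasible t ht') with hs | ⟨s, hs, h0, hsC⟩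
  · rw [hs] at hlt; exact not_top_lt hlt
  have hst : s < t := WithTop.coe_lt_coe.1 (hs ▸ hlt)
  have h1 := h.underbid_gap hK hrmin ht' ht.2 hlt
  obtain ⟨r, hr, h2, h3⟩ := exists_mem_Ioo_of_ae hf_meas hf_pos
    ((h.ae_truthful hK hη hC_pos hrmin).and (measure_eq_zero_iff_ae_notMem.1 h1))
    -- The types between `max s rmin` and `t` bid inside the gap. At `t = rmin` there are none, so
    -- the bid of the lowest type is not determined.
    (max_lt hst ht.1) (le_max_right _ _) ht'.2
  refine h3 ?_
  rw [mem_preimage, h2 (hr.2.trans_le ht.2), hs]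
  exact ⟨WithTop.coe_le_coe.2 ((le_max_left _ _).trans hr.1.le), WithTop.coe_lt_coe.2 hr.2⟩

theorem exists_threshold (h : IsSBNE K η rmin rmax f C b) (hK : 2 ≤ K) (hη : η ∈ Ioo (0 : ℝ) 1)
    (hrmin : 0 ≤ rmin) (hf_meas : Measurable f)
    (hf_pos : ∀ r ∈ Icc rmin rmax, 0 < f r) (hC : C ∈ Ico rmin rmax) (hC_pos : 0 < C) :
    ∃ rT ∈ Ioo C rmax,
      thresholdFun K η (ProbabilityTheory.cdf (typeLaw rmin rmax f)) C rT = 0 ∧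
        HasThreeRegionForm rmin rmax C rT b := by
  have := nullSingletonClass_typeLaw (rmin := rmin) (rmax := rmax) (f := f)
  have hq := h.refusal_pos hK hf_meas hf_pos hC hC_pos
  have hp := h.reserve_pos hK hη hf_meas hf_pos hC hC_pos
  have hanti : StrictAnti (advantage K η rmin rmax f C b) :=
    strictAnti_reserveAdvantage hK hη.1 hp.le hq
  have hpos : 0 < advantage K η rmin rmax f C b C :=
    reserveAdvantage_reserve_pos hK hη.2 hC_pos hq
  have hlow : ∀ r ∈ Icc rmin C, b r ≤ r := fun r hr =>
    h.not_overbid hK hη.2 hrmin hf_meas hf_pos hC hC_pos hq hr.1 hr.2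
  -- some type below `rmax` refuses
  obtain ⟨t₁, ht₁, hbt₁⟩ : ∃ t ∈ Ioo C rmax, b t = ⊤ := by
    by_contra! hno
    refine hq.ne' ((measureReal_eq_zero_iff).2 (measure_eq_zero_iff_ae_notMem.2 ?_))
    -- The type `rmax` has no mass; a refusing type strictly below it is what gives `rT < rmax`.
    filter_upwards [ae_mem_Icc_typeLaw, Measure.ae_ne _ rmax] with r hr hne htop
    rcases le_or_gt r C with hrC | hrC
    · have := hlow r ⟨hr.1, hrC⟩
      rw [show b r = ⊤ from htop] at this
      exact absurd this (not_le.2 (WithTop.coe_lt_top r))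
    · exact hno r ⟨hrC, lt_of_le_of_ne hr.2 hne⟩ htop
  have hneg := h.advantage_nonpos hK hC_pos ⟨hC.1.trans ht₁.1.le, ht₁.2.le⟩ hbt₁
  obtain ⟨rT, hrT, hzero⟩ := intermediate_value_Icc' ht₁.1.le
    (continuous_reserveAdvantage (K := K) (η := η) (C := C)
      (p := (typeLaw rmin rmax f).real (b ⁻¹' {(C : Bid)}))
      (q := (typeLaw rmin rmax f).real (b ⁻¹' {⊤}))).continuousOn ⟨hneg, hpos.le⟩
  have hCT : C < rT := lt_of_le_of_ne hrT.1 fun he => by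
    rw [← he] at hzero
    exact hpos.ne' hzero
  have hTmax : rT < rmax := hrT.2.trans_lt ht₁.2
  have hform : HasThreeRegionForm rmin rmax C rT b := by
    refine ⟨?_, fun r hr => h.truthful hK hη.2 hrmin hf_meas hf_pos hC hC_pos hq hr, ?_,
      h.reserve_or_refuse hK hC_pos hp ⟨hC.1.trans hCT.le, hTmax.le⟩ hCT, ?_⟩
    · have h1 := hlow rmin ⟨le_rfl, hC.1⟩
      rcases feasibleBids_cases (h.feasible rmin ⟨le_rfl, hC.1.trans hC.2.le⟩) with
        hs | ⟨s, hs, h0, hsC⟩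
      · rw [hs] at h1
        exact absurd h1 (not_le.2 (WithTop.coe_lt_top _))
      · rw [hs] at h1
        exact ⟨s, ⟨h0, WithTop.coe_le_coe.1 h1⟩, hs⟩
    · intro r hr
      have hr' : r ∈ Icc rmin rmax := ⟨hC.1.trans hr.1.le, hr.2.le.trans hTmax.le⟩
      refine (h.reserve_or_refuse hK hC_pos hp hr' hr.1).resolve_right fun htop => ?_
      exact absurd (h.advantage_nonpos hK hC_pos hr' htop)
        (not_le.2 (hzero.symm.trans_lt (hanti hr.2)))
    · intro r hr
      have hr' : r ∈ Icc rmin rmax := ⟨(hC.1.trans hCT.le).trans hr.1.le, hr.2⟩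
      refine (h.reserve_or_refuse hK hC_pos hp hr' (hCT.trans hr.1)).resolve_left fun hres => ?_
      exact absurd (h.advantage_nonneg hK hC_pos hr' hres)
        (not_le.2 ((hanti hr.1).trans_eq hzero))
  refine ⟨rT, ⟨hCT, hTmax⟩, ?_, hform⟩
  -- So far `rT` is a zero for the bid probabilities of `b`. The form just shown expresses these
  -- through the distribution function at `rT`.
  rw [thresholdFun_eq, ← hform.measureReal_reserve ae_mem_Icc_typeLaw hCT.le,
    ← hform.measureReal_refuse ae_mem_Icc_typeLaw hCT.le]
  exact hzero

end IsSBNE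

/-! ### Sufficiency: the three-region form is an equilibrium -/

section Converse

variable {K : ℕ} {η rmin rmax C rT t s : ℝ} {f : ℝ → ℝ} {b : ℝ → Bid}

/-- Against rivals that all bid at least `t`, underbidding changes neither the price nor the
outcome, except for a tie at `t`, where the surplus is zero. This makes every bid in `[0, rmin]`
optimal for the lowest type. -/
lemma rivalPayoff_truthful_le_of_le_minRival {ι : Type*} [Fintype ι] {x : ι → Bid}
    (htC : t ≤ C) (hst : s ≤ t) (hx : (t : Bid) ≤ minRival x) :
    rivalPayoff K η C t t x ≤ rivalPayoff K η C t s x := by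
  rcases hst.eq_or_lt with rfl | hst
  · rfl
  rcases h : minRival x with _ | m
  · rw [rivalPayoff_of_gt_top h, rivalPayoff_of_gt_top h]
  · have htm : t ≤ m := WithTop.coe_le_coe.1 (hx.trans_eq h)
    rw [rivalPayoff_of_gt_coe h (hst.trans_le htm)]
    rcases htm.eq_or_lt with rfl | htm
    · rw [rivalPayoff_of_eq h, min_eq_right htC]; simp
    · rw [rivalPayoff_of_gt_coe h htm]

theorem HasThreeRegionForm.isSBNE (h : HasThreeRegionForm rmin rmax C rT b)
    [IsProbabilityMeasure (typeLaw rmin rmax f)] (hK : 2 ≤ K) (hη : η ∈ Ioo (0 : ℝ) 1)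
    (hrmin : 0 ≤ rmin) (hC : C ∈ Ico rmin rmax) (hC_pos : 0 < C) (hrT : rT ∈ Ioo C rmax)
    (hzero : thresholdFun K η (ProbabilityTheory.cdf (typeLaw rmin rmax f)) C rT = 0) :
    IsSBNE K η rmin rmax f C b := by
  have := nullSingletonClass_typeLaw (rmin := rmin) (rmax := rmax) (f := f)
  have hmeas : AEMeasurable b (typeLaw rmin rmax f) := h.aemeasurable ae_mem_Icc_typeLaw
  -- The last two regions both contain `rT`, so that either bid of the threshold type is covered.
  have hregion : ∀ r ∈ Icc rmin rmax,
      (r = rmin ∧ ∃ x ∈ Icc 0 rmin, b r = (x : Bid)) ∨ (r ∈ Ioc rmin C ∧ b r = r) ∨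
        (C < r ∧ r ≤ rT ∧ b r = C) ∨ (C < r ∧ rT ≤ r ∧ b r = ⊤) := by
    intro r hr
    rcases hr.1.eq_or_lt with rfl | h1
    · exact Or.inl ⟨rfl, h.at_min⟩
    rcases le_or_gt r C with h2 | h2
    · exact Or.inr (Or.inl ⟨⟨h1, h2⟩, h.truthful r ⟨h1, h2⟩⟩)
    rcases lt_trichotomy r rT with h3 | rfl | h3
    · exact Or.inr (Or.inr (Or.inl ⟨h2, h3.le, h.reserve r ⟨h2, h3⟩⟩))
    · rcases h.at_threshold with h4 | h4
      · exact Or.inr (Or.inr (Or.inl ⟨h2, le_rfl, h4⟩))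
      · exact Or.inr (Or.inr (Or.inr ⟨h2, le_rfl, h4⟩))
    · exact Or.inr (Or.inr (Or.inr ⟨h2, h3.le, h.refuse r ⟨h3, hr.2⟩⟩))
  have hfeas : ∀ r ∈ Icc rmin rmax, b r ∈ feasibleBids C := by
    intro r hr
    rcases hregion r hr with ⟨-, x, hx, hb⟩ | ⟨h1, hb⟩ | ⟨-, -, hb⟩ | ⟨-, -, hb⟩ <;> rw [hb]
    · exact coe_mem_feasibleBids hx.1 (hx.2.trans hC.1)
    · exact coe_mem_feasibleBids (hrmin.trans h1.1.le) h1.2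
    · exact coe_mem_feasibleBids hC_pos.le le_rfl
    · exact top_mem_feasibleBids
  have hadv : ∀ (k : Fin K) (t : ℝ), expectedPayoff (typeLaw rmin rmax f) η C b k t C
      - expectedPayoff (typeLaw rmin rmax f) η C b k t ⊤
        = reserveAdvantage K η C ((typeLaw rmin rmax f).real (b ⁻¹' {(C : Bid)}))
          ((typeLaw rmin rmax f).real (b ⁻¹' {⊤})) t := fun k t =>
    expectedPayoff_reserve_sub_top hK hC_pos.le hmeas
      (ae_mem_Icc_typeLaw.mono fun r hr => lt_or_eq_or_top_of_mem_feasibleBids (hfeas r hr))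
  have hanti : Antitone (reserveAdvantage K η C ((typeLaw rmin rmax f).real (b ⁻¹' {(C : Bid)}))
      ((typeLaw rmin rmax f).real (b ⁻¹' {⊤}))) :=
    antitone_reserveAdvantage hK hη.1 measureReal_nonneg measureReal_nonneg
  rw [thresholdFun_eq, ← h.measureReal_reserve ae_mem_Icc_typeLaw hrT.1.le,
    ← h.measureReal_refuse ae_mem_Icc_typeLaw hrT.1.le] at hzero
  have htruth : ∀ (k : Fin K) (t : ℝ), 0 ≤ t → t ≤ C → ∀ s ∈ feasibleBids C,
      expectedPayoff (typeLaw rmin rmax f) η C b k t s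
        ≤ expectedPayoff (typeLaw rmin rmax f) η C b k t t := by
    intro k t ht htC s hs
    refine expectedPayoff_le hmeas hC_pos.le hs (coe_mem_feasibleBids ht htC)
      (Filter.Eventually.of_forall fun ρ => ?_)
    rcases feasibleBids_cases hs with rfl | ⟨s, rfl, -, hsC⟩
    · exact rivalPayoff_top_le_truthful hK hη.2 hC_pos ht htC
    · exact rivalPayoff_le_truthful htC hsC
  have hreserve : ∀ (k : Fin K) (t : ℝ), C ≤ t → ∀ s ∈ feasibleBids C, s ≠ ⊤ →
      expectedPayoff (typeLaw rmin rmax f) η C b k t s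
        ≤ expectedPayoff (typeLaw rmin rmax f) η C b k t C := by
    intro k t htC s hs hne
    refine expectedPayoff_le hmeas hC_pos.le hs (coe_mem_feasibleBids hC_pos.le le_rfl)
      (Filter.Eventually.of_forall fun ρ => ?_)
    obtain ⟨s, rfl, -, hsC⟩ := (feasibleBids_cases hs).resolve_left hne
    exact rivalPayoff_le_reserve htC hsC
  refine ⟨hmeas, hfeas, fun k r hr s hs => ?_⟩
  rcases hregion r hr with ⟨rfl, x, hx, hb⟩ | ⟨h1, hb⟩ | ⟨h1, h2, hb⟩ | ⟨h1, h2, hb⟩ <;> rw [hb]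
  -- The lowest type: truth beats `s`, and its actual bid does as well as truth because almost
  -- surely no rival bids below `rmin`.
  · refine (htruth k r hrmin hC.1 s hs).trans ?_
    refine expectedPayoff_le hmeas hC_pos.le (coe_mem_feasibleBids hrmin hC.1)
      (coe_mem_feasibleBids hx.1 (hx.2.trans hC.1)) ?_
    have hge : ∀ᵐ t ∂typeLaw r rmax f, (r : Bid) ≤ b t := by
      filter_upwards [ae_mem_Icc_typeLaw, Measure.ae_ne _ r] with t ht hne
      rcases hregion t ht with ⟨h1, -⟩ | ⟨h1, hb⟩ | ⟨h1, h2, hb⟩ | ⟨h1, h2, hb⟩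
      · exact absurd h1 hne
      all_goals rw [hb]
      · exact WithTop.coe_le_coe.2 h1.1.le
      · exact WithTop.coe_le_coe.2 hC.1
      · exact le_top
    filter_upwards [ae_all_bids (ι := {j : Fin K // j ≠ k}) (p := fun z => (r : Bid) ≤ z) hge]
      with ρ hρ
    exact rivalPayoff_truthful_le_of_le_minRival hC.1 hx.2 (Finset.le_inf fun j _ => hρ j)
  · exact htruth k r (hrmin.trans hr.1) h1.2 s hs
  -- The advantage vanishes at `rT` and is monotone, which gives its sign at `r ≤ rT` here and at `r
  -- ≥ rT` in the last case.
  · have h3 := (hzero.symm.trans_le (hanti h2)).trans_eq (hadv k r).symm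
    by_cases hst : s = ⊤
    · rw [hst]; exact sub_nonneg.1 h3
    · exact hreserve k r h1.le s hs hst
  · have h3 := (hadv k r).trans_le ((hanti h2).trans_eq hzero)
    by_cases hst : s = ⊤
    · rw [hst]
    · exact (hreserve k r h1.le s hs hst).trans (sub_nonpos.1 h3)

end Converse

end ReverseAuction
end

theorem theorem2 (K : ℕ) (hK : 2 ≤ K) (η : ℝ) (hη : η ∈ Set.Ioo (0 : ℝ) 1)
    (rmin rmax : ℝ) (hrmin : 0 ≤ rmin)
    (f : ℝ → ℝ) (hf_meas : Measurable f) (hf_pos : ∀ r ∈ Set.Icc rmin rmax, 0 < f r)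
    (hf_int : ∫⁻ r in Set.Icc rmin rmax, ENNReal.ofReal (f r) = 1)
    (C : ℝ) (hC : C ∈ Set.Ico rmin rmax) (hC_pos : 0 < C) (b : ℝ → ReverseAuction.Bid) :
    ReverseAuction.IsSBNE K η rmin rmax f C b ↔
      ∃ rT ∈ Set.Ioo C rmax,
        ReverseAuction.thresholdFun K η
            (ProbabilityTheory.cdf (ReverseAuction.typeLaw rmin rmax f)) C rT = 0 ∧
          ReverseAuction.HasThreeRegionForm rmin rmax C rT b := by
  have := ReverseAuction.isProbabilityMeasure_typeLaw hf_int
  constructor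
  · intro h
    exact h.exists_threshold hK hη hrmin hf_meas hf_pos hC hC_pos
  · rintro ⟨rT, hrT, hzero, hform⟩
    exact hform.isSBNE hK hη hrmin hC hC_pos hrT hzero
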